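/- **Setting.** A periodic soft real-time task with period $T>0$, relative deadline $D>0$ and relative dismiss point $\delta\ge 0$ (finite) releases jobs $J_1,J_2,\dots$; $J_j$ is released at $(j-1)T$, has absolute deadline $(j-1)T+D$, and what is left of it at $(j-1)T+D+\delta$ is dismissed. The execution times $C_1,C_2,\dots$ are independent and identically distributed with finitely many positive values $e_1<\dots<e_h$, $h\ge1$, $\sum_k\mathbb P(C_j=e_k)=1$. The jobs are served by a greedy processing component, in first-come-first-serve order and whenever it has capacity. The service that it provides is deterministic: for $0\le t\le T$, $\beta_j(t)$ is the service in $[(j-1)T,(j-1)T+t)$, where $\beta_j(0)=0$, $\beta_j$ is non-decreasing, $\beta_j(t+\epsilon)\le\beta_j(t)+\epsilon$ for $\epsilon>0$ and $t+\epsilon\le T$, and $\beta_{j+Q}=\beta_j$ for some fixed integer $Q\ge1$ and all $j$. Put $$service(j,t)=\sum_{\ell=j}^{j+\lfloor t/T\rfloor-1}\beta_\ell(T)+\beta_{j+\lfloor t/T\rfloor}\bigl(t-T\lfloor t/T\rfloor\bigr).$$ Let $\mathrm{DM}(j)=1$ if $J_j$ is not finished by its deadline and $\mathrm{DM}(j)=0$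 otherwise, and $\mathrm{DMR}_N=\frac1N\sum_{j=1}^N\mathrm{DM}(j)$. A constant to which $\mathrm{DMR}_N$ converges almost surely as $N\to\infty$ is called the *deadline miss rate* of the task. **The chain.** A state is a triple of a position $i\in\{1,\dots,Q\}$, a hit/miss indicator, and a backlog. A job at position $i$ with execution time $x$ that finds the backlog $w$ at its release has the state $(i,\text{hit},\max\{x+w-\beta_i(T),0\})$ if $x+w\le service(i,D)$, and $(i,\text{miss},\max\{\min\{x+w,service(i,D+\delta)\}-\beta_i(T),0\})$ otherwise. The state expansion starts with the states of a job at position $1$ with $w=0$ and $x=e_1,\dots,e_h$. It adds, for each state with position $i$ and backlog $w$ that it has created and each $k$, the state of a job at position $(i \bmod Q)+1$ with the backlog $w$ and execution time $e_k$; identical states are merged. It terminates if and only if the set $S$ of states that arise in this way is finite. The probability $P_{r,s}$ of moving from $s\in S$ to $r\in S$ is the sum of the $\mathbb P(C_j=e_k)$ over those $k$ for which $s$ is followed by $r$. The chain is irreducible if from every state each state can be reached by a path of transitions with positive probability. Let $S_{\mathrm{DM}}\subseteq S$ be the set of states with indicator "miss". **Theorem.** (i) If $T$, $D$, $\delta$,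 all $e_k$, and all $\beta_j(m)$ with integer $0\le m\le T$ are integers, then $S$ is finite. (ii) In general, if $S$ is finite and the chain is irreducible, then there is exactly one probability distribution $\pi$ on $S$ with $P\pi=\pi$, and the deadline miss rate of the task exists and equals $\sum_{s\in S_{\mathrm{DM}}}\pi_s$. -/

import Mathlib

open MeasureTheory ProbabilityTheory Filter Topology
open scoped Matrix

/-- A periodic soft real-time task: period `T`, relative deadline `D`, relative dismiss point `δ`
after the deadline, and an execution-time distribution with the `h` distinct values
`e 0 < ... < e (h - 1)`, the value `e k` having probability `p k`. -/
structure SoftTask where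
  T : ℝ
  D : ℝ
  δ : ℝ
  h : ℕ
  e : Fin h → ℝ
  p : Fin h → ℝ
  T_pos : 0 < T
  D_pos : 0 < D
  δ_nonneg : 0 ≤ δ
  e_strictMono : StrictMono e
  e_pos : ∀ k, 0 < e k
  p_nonneg : ∀ k, 0 ≤ p k
  p_sum : ∑ k, p k = 1

/-- Deterministic supply functions of a greedy processing component, repeating every `Q` jobs.
Jobs are numbered from `0`: `β j t` is the service provided during `[j T, j T + t)`, for
`0 ≤ t ≤ T` (values outside this range are irrelevant). -/
structure SupplyFunctions (T : ℝ) where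
  Q : ℕ
  β : ℕ → ℝ → ℝ
  Q_pos : 0 < Q
  β_zero : ∀ j, β j 0 = 0
  β_mono : ∀ j, MonotoneOn (β j) (Set.Icc 0 T)
  β_rate : ∀ j t ε, 0 ≤ t → 0 < ε → t + ε ≤ T → β j (t + ε) ≤ β j t + ε
  β_periodic : ∀ j, ∀ t ∈ Set.Icc 0 T, β (j + Q) t = β j t

noncomputable section

/-- The accumulated service in `[j T, j T + t)`, for `0 ≤ t`. -/
def service {T : ℝ} (G : SupplyFunctions T) (j : ℕ) (t : ℝ) : ℝ :=
  ∑ l ∈ Finset.Ico j (j + ⌊t / T⌋₊), G.β l T + G.β (j + ⌊t / T⌋₊) (t - T * ⌊t / T⌋₊)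

namespace SoftTask

variable (τ : SoftTask) (G : SupplyFunctions τ.T)

/-! ### The schedule: greedy first-come-first-serve processing with dismissal

Throughout, `c j` is the actual execution time of job `j`. -/

/-- Release time of job `j`. -/
def release (j : ℕ) : ℝ := j * τ.T

/-- Absolute deadline of job `j`. -/
def deadline (j : ℕ) : ℝ := j * τ.T + τ.D

/-- Absolute dismiss point of job `j`. -/
def dismissPoint (j : ℕ) : ℝ := j * τ.T + τ.D + τ.δ

/-- If the component is available to job `j` from time `a` on and all the service from then on goes
to this job, then this is the time at which the job leaves: the first time at which it has received
its execution time `x` or its dismiss point is reached. -/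
def leaveTime (a x : ℝ) (j : ℕ) : ℝ :=
  sInf {t : ℝ | a ≤ t ∧ (x ≤ service G 0 t - service G 0 a ∨ τ.dismissPoint j ≤ t)}

/-- The time from which the component is available to job `j`: the job is released and the
preceding job (hence, by first-come-first-serve, each preceding job) has left, that is, it is
finished or dismissed. -/
def startTime (c : ℕ → ℝ) : ℕ → ℝ
  | 0 => τ.release 0
  | j + 1 => max (τ.release (j + 1)) (τ.leaveTime G (startTime c j) (c j) j)

/-- Job `j` meets its deadline: it has received its execution time at some time that is not after
its deadline. -/
def MeetsDeadline (c : ℕ → ℝ) (j : ℕ) : Prop :=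
  ∃ t, τ.startTime G c j ≤ t ∧ t ≤ τ.deadline j ∧
    c j ≤ service G 0 t - service G 0 (τ.startTime G c j)

open Classical in
/-- Deadline miss indicator of job `j`. -/
def DM (c : ℕ → ℝ) (j : ℕ) : ℝ := if τ.MeetsDeadline G c j then 0 else 1

/-- Deadline miss rate of the first `N` jobs. -/
def DMRN (c : ℕ → ℝ) (N : ℕ) : ℝ := (1 / (N : ℝ)) * ∑ j ∈ Finset.range N, τ.DM G c j

/-- `r` is the deadline miss rate of the task when the execution time of job `j` is the random
variable `C j`: the deadline miss rate of the first `N` jobs converges almost surely to `r`. -/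
def IsDeadlineMissRate {Ω : Type*} [MeasurableSpace Ω] (μ : Measure Ω) (C : ℕ → Ω → ℝ)
    (r : ℝ) : Prop :=
  ∀ᵐ ω ∂μ, Tendsto (fun N => τ.DMRN G (fun j => C j ω) N) atTop (𝓝 r)

/-- The execution times of the jobs are independent and all have the distribution of the task. -/
structure IsExecutionTimes {Ω : Type*} [MeasurableSpace Ω] (μ : Measure Ω)
    (C : ℕ → Ω → ℝ) : Prop where
  measurable : ∀ j, Measurable (C j)
  indep : iIndepFun C μ
  law : ∀ j k, μ.real {ω | C j ω = τ.e k} = τ.p k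

end SoftTask

/-! ### The Markov chain built by state expansion -/

/-- A candidate state: the position `pos` of the job in the repeating pattern of `Q` jobs, whether
the job misses its deadline, and the backlog `rem` at the end of the period of the job that is
still to be executed after it, the part to be dismissed being removed. -/
@[ext] structure ChainState where
  pos : ℕ
  miss : Bool
  rem : ℝ

namespace SoftTask

variable (τ : SoftTask) (G : SupplyFunctions τ.T)

open Classical in
/-- The state of a job at position `i` with execution time `x` that finds the backlog `w` at its
release. -/
def expand (i : ℕ) (w x : ℝ) : ChainState :=
  if x + w ≤ service G i τ.D then
    ⟨i, false, max (x + w - G.β i τ.T) 0⟩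
  else
    ⟨i, true, max (min (w + x) (service G i (τ.D + τ.δ)) - G.β i τ.T) 0⟩

/-- The initial state for the execution time `e k`. -/
def initState (k : Fin τ.h) : ChainState := τ.expand G 0 0 (τ.e k)

/-- The successor of the state `s` when the next job has execution time `e k`. -/
def nextState (s : ChainState) (k : Fin τ.h) : ChainState :=
  τ.expand G ((s.pos + 1) % G.Q) s.rem (τ.e k)

/-- The states that are created: those of the first job, and the successors of created states
(identical states are merged). -/
inductive IsCreated : ChainState → Prop
  | init (k : Fin τ.h) : IsCreated (τ.initState G k)
  | next (s : ChainState) (k : Fin τ.h) : IsCreated s → IsCreated (τ.nextState G s k)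

/-- The state space of the chain. The state expansion terminates if and only if it is finite. -/
abbrev State : Type := {s : ChainState // τ.IsCreated G s}

open Classical in
/-- The (left stochastic) transition matrix: the entry at `(r, s)` is the probability of moving
from `s` to `r`. -/
def transitionMatrix : Matrix (τ.State G) (τ.State G) ℝ :=
  fun r s => ∑ k with τ.nextState G s k = r, τ.p k

/-- Stationary distributions of the chain. -/
def IsStationary [Fintype (τ.State G)] (π : τ.State G → ℝ) : Prop :=
  (∀ s, 0 ≤ π s) ∧ ∑ s, π s = 1 ∧ τ.transitionMatrix G *ᵥ π = π

/-- All variables are integers, and the service provided up to an integer time is an integer. -/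
def IsIntegral : Prop :=
  (∃ n : ℤ, τ.T = n) ∧ (∃ n : ℤ, τ.D = n) ∧ (∃ n : ℤ, τ.δ = n) ∧ (∀ k, ∃ n : ℤ, τ.e k = n) ∧
    ∀ (j m : ℕ), (m : ℝ) ≤ τ.T → ∃ n : ℤ, G.β j m = n

end SoftTask

end

/-! The past influences a job only through the backlog that the job finds at its release. Cumulative
service is monotone and 1-Lipschitz, so under greedy first-come-first-serve the backlog obeys w' =
max(min(x + w, service(j, D + δ)) - β_j(T), 0) (`backlog_succ`), and the deadline is met iff x + w ≤
service(j, D) (`meetsDeadline_iff`). These are the rules of the state expansion: the schedule runs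
through the chain, driven by independent execution times, and a miss is visible in the state.

For (i), backlogs are integers between 0 and the service until the dismiss point, and positions and
indicators are finite in number.

For (ii), positions rotate, so the chain is periodic when Q > 1 and its laws need not converge; time
averages are treated directly. By the maximum principle, left fixed vectors of the irreducible
matrix A are constant. Rank counting then gives a one-dimensional space of right fixed vectors,
hence π, and solves the Poisson equation f - πf = g - gA (`exists_poisson`) for the miss indicator
f. Along a trajectory its sum is a bounded telescoping term plus bounded martingale differences,
whose averages vanish by a second moment argument (`ae_tendsto_average_of_orthogonal`). -/

namespace Matrix

/-! ### Irreducible stochastic matrices and the Poisson equation -/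

variable {S : Type*} [Fintype S] {A : Matrix S S ℝ}

/-- Maximum principle: a left eigenvector for the eigenvalue `1` of an irreducible matrix with
column sums `1` is constant. -/
theorem IsIrreducible.eq_of_vecMul_eq (hA : A.IsIrreducible) (hcol : ∀ s, ∑ r, A r s = 1)
    {g : S → ℝ} (hg : g ᵥ* A = g) (a b : S) : g a = g b := by
  have : Nonempty S := ⟨a⟩
  obtain ⟨m, hm⟩ := Finite.exists_max g
  -- The value `g s` is the average of `g` with weights `A r s`; if it is maximal, so is `g r`
  -- wherever the weight is positive.
  have step : ∀ r s, 0 < A r s → g s = g m → g r = g m := by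
    intro r s hrs hs
    have h1 : ∑ r, A r s * (g m - g r) = 0 := by
      have h2 : ∑ r, g r * A r s = g s := congrFun hg s
      simp only [mul_sub, Finset.sum_sub_distrib, ← Finset.sum_mul, hcol]
      simp only [mul_comm (A _ s), h2, hs]
      ring
    have h3 := (Finset.sum_eq_zero_iff_of_nonneg
      (fun r _ => mul_nonneg (hA.nonneg r s) (sub_nonneg.2 (hm r)))).1 h1 r (Finset.mem_univ r)
    rcases mul_eq_zero.1 h3 with h | h <;> linarith
  have key : ∀ a, g a = g m := by
    intro a
    let _ : Quiver S := toQuiver A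
    obtain ⟨p, -⟩ := hA.connected a m
    have : ∀ (b : S), Quiver.Path a b → g b = g m → g a = g m := by
      intro b p
      induction p with
      | nil => exact id
      | cons _ e ih => exact fun h => ih (step _ _ e.down h)
    exact this m p rfl
  rw [key a, key b]

/-- Constants lie in this kernel by the column sums; by the maximum principle nothing else does. -/
theorem IsIrreducible.finrank_ker_transpose [DecidableEq S] [Nonempty S] (hA : A.IsIrreducible)
    (hcol : ∀ s, ∑ r, A r s = 1) :
    Module.finrank ℝ (LinearMap.ker (1 - A)ᵀ.mulVecLin) = 1 := by
  obtain ⟨s₀⟩ := ‹Nonempty S›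
  refine finrank_eq_one_iff'.2 ⟨⟨1, ?_⟩, ?_, ?_⟩
  · ext s
    simp [vecMul, dotProduct, hcol]
  · intro h
    have := congrFun (congrArg Subtype.val h) s₀
    simp at this
  · rintro ⟨g, hg⟩
    refine ⟨g s₀, Subtype.ext (funext fun s => ?_)⟩
    have h1 : g ᵥ* A = g := by
      simpa [sub_mulVec, mulVec_transpose, sub_eq_zero, eq_comm] using hg
    simpa using hA.eq_of_vecMul_eq hcol h1 s₀ s

theorem IsIrreducible.finrank_ker [DecidableEq S] [Nonempty S] (hA : A.IsIrreducible)
    (hcol : ∀ s, ∑ r, A r s = 1) :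
    Module.finrank ℝ (LinearMap.ker (1 - A).mulVecLin) = 1 := by
  have h1 := hA.finrank_ker_transpose hcol
  have h2 := (1 - A).mulVecLin.finrank_range_add_finrank_ker
  have h3 := (1 - A)ᵀ.mulVecLin.finrank_range_add_finrank_ker
  have h4 := (1 - A).rank_transpose
  simp only [Matrix.rank] at h4
  lia

/-- For a fixed vector `v`, the triangle inequality gives |v| ≤ A|v| entrywise. Both sides have the
same total because columns sum to `1`, so |v| is fixed as well and can be normalised. -/
theorem IsIrreducible.exists_stationary [Nonempty S] (hA : A.IsIrreducible)
    (hcol : ∀ s, ∑ r, A r s = 1) :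
    ∃ π : S → ℝ, (∀ s, 0 ≤ π s) ∧ ∑ s, π s = 1 ∧ A *ᵥ π = π := by
  classical
  obtain ⟨⟨v, hv⟩, hv0, -⟩ := finrank_eq_one_iff'.1 (hA.finrank_ker hcol)
  replace hv : A *ᵥ v = v := by
    simpa [sub_mulVec, sub_eq_zero, eq_comm] using hv
  replace hv0 : v ≠ 0 := fun h => hv0 (Subtype.ext h)
  have hle : ∀ s, |v s| ≤ (A *ᵥ fun r => |v r|) s := fun s => by
    calc |v s| = |∑ r, A s r * v r| := by rw [← congrFun hv s]; simp [mulVec, dotProduct]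
      _ ≤ ∑ r, |A s r * v r| := Finset.abs_sum_le_sum_abs _ _
      _ = _ := by simp [mulVec, dotProduct, abs_mul, abs_of_nonneg (hA.nonneg s _)]
  have hsum : ∑ s, |v s| = ∑ s, (A *ᵥ fun r => |v r|) s := by
    simp only [mulVec, dotProduct]
    rw [Finset.sum_comm]
    simp [← Finset.sum_mul, hcol]
  have heq : ∀ s, |v s| = (A *ᵥ fun r => |v r|) s := fun s =>
    (Finset.sum_eq_sum_iff_of_le (fun s _ => hle s)).1 hsum s (Finset.mem_univ s)
  obtain ⟨s₁, hs₁⟩ := Function.ne_iff.1 hv0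
  have hpos : 0 < ∑ s, |v s| :=
    Finset.sum_pos' (fun s _ => abs_nonneg _) ⟨s₁, Finset.mem_univ _, abs_pos.2 hs₁⟩
  refine ⟨(∑ s, |v s|)⁻¹ • fun s => |v s|, fun s => ?_, ?_, ?_⟩
  · exact mul_nonneg (inv_nonneg.2 hpos.le) (abs_nonneg _)
  · simp [← Finset.mul_sum, hpos.ne']
  · rw [mulVec_smul, ← funext heq]

theorem IsIrreducible.stationary_unique [Nonempty S] (hA : A.IsIrreducible)
    (hcol : ∀ s, ∑ r, A r s = 1) {π π' : S → ℝ} (h1 : ∑ s, π s = 1) (hπ : A *ᵥ π = π)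
    (h1' : ∑ s, π' s = 1) (hπ' : A *ᵥ π' = π') : π' = π := by
  classical
  obtain ⟨⟨v, hv⟩, hv0, hs⟩ := finrank_eq_one_iff'.1 (hA.finrank_ker hcol)
  obtain ⟨a, ha⟩ := hs ⟨π, by simp [hπ]⟩
  obtain ⟨b, hb⟩ := hs ⟨π', by simp [hπ']⟩
  replace ha : a • v = π := congrArg Subtype.val ha
  replace hb : b • v = π' := congrArg Subtype.val hb
  subst ha hb
  simp only [Pi.smul_apply, smul_eq_mul, ← Finset.mul_sum] at h1 h1'
  have : ∑ s, v s ≠ 0 := fun h => by simp [h] at h1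
  rw [mul_right_cancel₀ this (h1.trans h1'.symm)]

/-- Solvability of the Poisson equation of an irreducible chain. -/
theorem IsIrreducible.exists_poisson [Nonempty S] (hA : A.IsIrreducible)
    (hcol : ∀ s, ∑ r, A r s = 1) {π : S → ℝ} (h1 : ∑ s, π s = 1) (hπ : A *ᵥ π = π)
    (f : S → ℝ) :
    ∃ g : S → ℝ, ∀ s, f s - ∑ r, π r * f r = g s - ∑ r, A r s * g r := by
  classical
  let φ : Module.Dual ℝ (S → ℝ) := dotProductBilin ℝ ℝ π
  have hφ : φ ≠ 0 := fun h => by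
    have : φ 1 = 0 := by rw [h]; rfl
    simp [φ, dotProduct, h1] at this
  have hker := Module.Dual.finrank_ker_add_one_of_ne_zero hφ
  -- Stationarity makes `π` annihilate this range. Both spaces have codimension one, so they
  -- coincide, and the centred `f` lies in the range.
  have hle : LinearMap.range (1 - A)ᵀ.mulVecLin ≤ LinearMap.ker φ := by
    rintro _ ⟨g, rfl⟩
    change π ⬝ᵥ ((1 - A)ᵀ *ᵥ g) = 0
    rw [dotProduct_mulVec, vecMul_transpose, sub_mulVec, hπ]
    simp
  have h2 := (1 - A)ᵀ.mulVecLin.finrank_range_add_finrank_ker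
  have h3 := hA.finrank_ker_transpose hcol
  have heq := Submodule.eq_of_le_of_finrank_eq hle (by lia)
  have hf : (fun s => f s - ∑ r, π r * f r) ∈ LinearMap.ker φ := by
    change π ⬝ᵥ (fun s => f s - ∑ r, π r * f r) = 0
    simp [dotProduct, mul_sub, ← Finset.sum_mul, h1]
  rw [← heq] at hf
  obtain ⟨g, hg⟩ := hf
  refine ⟨g, fun s => ?_⟩
  have := congrFun hg s
  simp only [mulVecLin_apply, mulVec_transpose, vecMul_sub, vecMul_one, Pi.sub_apply] at this
  rw [← this]
  simp [vecMul, dotProduct, mul_comm]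

end Matrix

/-! ### A strong law for bounded orthogonal increments -/

/-- If a bounded sequence has averages tending to `0` along the squares, then all its averages
tend to `0`. -/
theorem tendsto_average_of_tendsto_sq {d : ℕ → ℝ} {B : ℝ} (hB : ∀ n, |d n| ≤ B)
    (h : Tendsto (fun n : ℕ => (∑ i ∈ Finset.range (n ^ 2), d i) / (n : ℝ) ^ 2) atTop (𝓝 0)) :
    Tendsto (fun N : ℕ => (∑ i ∈ Finset.range N, d i) / (N : ℝ)) atTop (𝓝 0) := by
  have hsqrt : Tendsto Nat.sqrt atTop atTop := by
    refine tendsto_atTop.2 fun b => ?_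
    filter_upwards [eventually_ge_atTop (b ^ 2)] with N hN
    exact Nat.le_sqrt'.2 hN
  have hB0 : 0 ≤ B := (abs_nonneg _).trans (hB 0)
  -- The term `2 * B / n` accounts for the at most `2 * n` summands between `n ^ 2` and `N`, divided
  -- by `N ≥ n ^ 2`.
  have h1 : Tendsto (fun n : ℕ => |(∑ i ∈ Finset.range (n ^ 2), d i) / (n : ℝ) ^ 2|
      + 2 * B / n) atTop (𝓝 0) := by
    simpa using h.abs.add (tendsto_const_div_atTop_nhds_zero_nat (2 * B))
  refine squeeze_zero_norm' ?_ (h1.comp hsqrt)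
  filter_upwards [eventually_ge_atTop 1] with N hN
  simp only [Function.comp, Real.norm_eq_abs]
  set n := N.sqrt with hn
  have hn1 : 1 ≤ n := Nat.le_sqrt'.2 (by simpa using hN)
  have hle : n ^ 2 ≤ N := Nat.sqrt_le' N
  have hlt : N - n ^ 2 ≤ 2 * n := by
    have := Nat.sqrt_le_add N
    rw [← hn] at this
    have h' : n ^ 2 = n * n := sq n
    lia
  have hn0 : (0 : ℝ) < n := by exact_mod_cast hn1
  have hleR : (n : ℝ) ^ 2 ≤ N := by exact_mod_cast hle
  have hN0 : (0 : ℝ) < N := by exact_mod_cast hN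
  have hsplit : ∑ i ∈ Finset.range N, d i
      = ∑ i ∈ Finset.range (n ^ 2), d i + ∑ i ∈ Finset.Ico (n ^ 2) N, d i :=
    (Finset.sum_range_add_sum_Ico _ hle).symm
  have hgap : |∑ i ∈ Finset.Ico (n ^ 2) N, d i| ≤ 2 * n * B := by
    calc _ ≤ ∑ i ∈ Finset.Ico (n ^ 2) N, |d i| := Finset.abs_sum_le_sum_abs _ _
      _ ≤ ∑ _i ∈ Finset.Ico (n ^ 2) N, B := Finset.sum_le_sum fun i _ => hB i
      _ = (N - n ^ 2 : ℕ) * B := by simp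
      _ ≤ 2 * n * B := mul_le_mul_of_nonneg_right (by exact_mod_cast hlt) hB0
  rw [hsplit, abs_div, abs_of_pos hN0, abs_div, abs_of_pos (pow_pos hn0 2)]
  calc _ ≤ (|∑ i ∈ Finset.range (n ^ 2), d i| + 2 * n * B) / N := by
        gcongr
        exact (abs_add_le _ _).trans (by gcongr)
    _ ≤ (|∑ i ∈ Finset.range (n ^ 2), d i| + 2 * n * B) / n ^ 2 := by gcongr
    _ = _ := by field_simp

namespace MeasureTheory

variable {Ω : Type*} [MeasurableSpace Ω] {μ : Measure Ω} [IsProbabilityMeasure μ]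

/-- A strong law of large numbers for bounded random variables each of which is orthogonal to the
sum of the preceding ones. -/
theorem ae_tendsto_average_of_orthogonal {D : ℕ → Ω → ℝ} {B : ℝ} (hD : ∀ n, Measurable (D n))
    (hB : ∀ n ω, |D n ω| ≤ B)
    (horth : ∀ n, ∫ ω, (∑ i ∈ Finset.range n, D i ω) * D n ω ∂μ = 0) :
    ∀ᵐ ω ∂μ, Tendsto (fun N : ℕ => (∑ i ∈ Finset.range N, D i ω) / (N : ℝ)) atTop (𝓝 0) := by
  set M : ℕ → Ω → ℝ := fun n ω => ∑ i ∈ Finset.range n, D i ω with hM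
  have hMm : ∀ n, Measurable (M n) := fun n => Finset.measurable_fun_sum _ fun i _ => hD i
  have hMb : ∀ n ω, |M n ω| ≤ n * B := fun n ω => by
    calc _ ≤ ∑ i ∈ Finset.range n, |D i ω| := Finset.abs_sum_le_sum_abs _ _
      _ ≤ ∑ _i ∈ Finset.range n, B := Finset.sum_le_sum fun i _ => hB i ω
      _ = n * B := by simp
  have hint : ∀ {Y : Ω → ℝ} (b : ℝ), Measurable Y → (∀ ω, |Y ω| ≤ b) → Integrable Y μ :=
    fun b hY hb => Integrable.of_bound hY.aestronglyMeasurable b (ae_of_all _ hb)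
  have hsqB : ∀ {x b : ℝ}, |x| ≤ b → |x ^ 2| ≤ b ^ 2 := fun {x b} h => by
    rw [abs_pow]; gcongr
  have hiM : ∀ n, Integrable (fun ω => M n ω ^ 2) μ := fun n =>
    hint ((n * B) ^ 2) ((hMm n).pow_const 2) fun ω => hsqB (hMb n ω)
  have hiD : ∀ n, Integrable (fun ω => D n ω ^ 2) μ := fun n =>
    hint (B ^ 2) ((hD n).pow_const 2) fun ω => hsqB (hB n ω)
  have hiMD : ∀ n, Integrable (fun ω => M n ω * D n ω) μ := fun n =>
    hint (n * B * B) ((hMm n).mul (hD n)) fun ω => by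
      rw [abs_mul]
      exact mul_le_mul (hMb n ω) (hB n ω) (abs_nonneg _) ((abs_nonneg _).trans (hMb n ω))
  -- Orthogonality removes the cross term, so second moments grow only linearly.
  have hvar : ∀ n : ℕ, ∫ ω, M n ω ^ 2 ∂μ ≤ n * B ^ 2 := by
    intro n
    induction n with
    | zero => simp [hM]
    | succ n ih =>
      have h1 : ∀ ω, M (n + 1) ω ^ 2 = M n ω ^ 2 + 2 * (M n ω * D n ω) + D n ω ^ 2 := fun ω => by
        simp only [hM, Finset.sum_range_succ]; ring
      have h2 : ∫ ω, D n ω ^ 2 ∂μ ≤ B ^ 2 := by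
        calc _ ≤ ∫ _ω, B ^ 2 ∂μ := integral_mono (hiD n) (integrable_const _) fun ω =>
              (le_abs_self _).trans (hsqB (hB n ω))
          _ = B ^ 2 := by simp
      simp only [h1]
      have h3 : Integrable (fun ω => M n ω ^ 2 + 2 * (M n ω * D n ω)) μ :=
        (hiM n).add ((hiMD n).const_mul 2)
      rw [integral_add h3 (hiD n), integral_add (hiM n) ((hiMD n).const_mul 2), integral_const_mul, horth n]
      push_cast
      linarith
  -- Along the squares the second moments are at most `B ^ 2 / n ^ 2`, which is summable. Hence the
  -- sum of the `Y n ω ^ 2` is finite almost surely, and `Y n ω` tends to `0`.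
  set Y : ℕ → Ω → ℝ := fun n ω => M (n ^ 2) ω / (n : ℝ) ^ 2 with hY
  have hYm : ∀ n, Measurable fun ω => ENNReal.ofReal (Y n ω ^ 2) := fun n =>
    (((hMm (n ^ 2)).div_const _).pow_const 2).ennreal_ofReal
  have hYi : ∀ n, ∫⁻ ω, ENNReal.ofReal (Y n ω ^ 2) ∂μ ≤ ENNReal.ofReal (B ^ 2 / (n : ℝ) ^ 2) := by
    intro n
    have h1 : ∀ ω, Y n ω ^ 2 = M (n ^ 2) ω ^ 2 * (((n : ℝ) ^ 2)⁻¹) ^ 2 := fun ω => by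
      simp only [hY]; rw [div_eq_mul_inv, mul_pow]
    have hYint : Integrable (fun ω => Y n ω ^ 2) μ := by
      simp only [h1]; exact (hiM _).mul_const _
    rw [← ofReal_integral_eq_lintegral_ofReal hYint (ae_of_all _ fun ω => sq_nonneg _)]
    refine ENNReal.ofReal_le_ofReal ?_
    simp only [h1, integral_mul_const]
    have h2 := hvar (n ^ 2)
    push_cast at h2
    calc _ ≤ (n : ℝ) ^ 2 * B ^ 2 * (((n : ℝ) ^ 2)⁻¹) ^ 2 := by gcongr
      _ = _ := by
        rcases eq_or_ne (n : ℝ) 0 with h | h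
        · simp [h]
        · field_simp
  have hsum : ∑' n, ∫⁻ ω, ENNReal.ofReal (Y n ω ^ 2) ∂μ ≠ ⊤ := by
    have hs : Summable fun n : ℕ => B ^ 2 / (n : ℝ) ^ 2 := by
      simpa [div_eq_mul_inv] using
        (Real.summable_nat_pow_inv.2 (by norm_num : 1 < 2)).mul_left (B ^ 2)
    refine ne_top_of_le_ne_top ?_ (ENNReal.tsum_le_tsum hYi)
    rw [← ENNReal.ofReal_tsum_of_nonneg (fun n => by positivity) hs]
    exact ENNReal.ofReal_ne_top
  rw [← lintegral_tsum fun n => (hYm n).aemeasurable] at hsum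
  filter_upwards [ae_lt_top (Measurable.tsum hYm) hsum] with ω hω
  refine tendsto_average_of_tendsto_sq (fun n => hB n ω) ?_
  have h1 := ENNReal.tendsto_atTop_zero_of_tsum_ne_top hω.ne
  have h2 := (ENNReal.tendsto_toReal ENNReal.zero_ne_top).comp h1
  simp only [Function.comp_def, ENNReal.toReal_zero, ENNReal.toReal_ofReal (sq_nonneg _)] at h2
  have h3 := h2.sqrt
  simp only [Real.sqrt_sq_eq_abs, Real.sqrt_zero] at h3
  exact tendsto_zero_iff_abs_tendsto_zero _ |>.2 h3

end MeasureTheory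

/-! ### Ergodic averages from the Poisson equation -/

namespace ProbabilityTheory

variable {Ω : Type*} [MeasurableSpace Ω] {μ : Measure Ω} [IsProbabilityMeasure μ]
  {κ : Type*} [Fintype κ] [MeasurableSpace κ] [DiscreteMeasurableSpace κ]

/-- The `σ`-algebra generated by the variables with an index below `n`. -/
abbrev pastSigma (K : ℕ → Ω → κ) (n : ℕ) : MeasurableSpace Ω :=
  ⨆ i ∈ Set.Iio n, MeasurableSpace.comap (K i) inferInstance

omit [Fintype κ] [DiscreteMeasurableSpace κ] [IsProbabilityMeasure μ] in
theorem iIndepFun.indep_pastSigma {K : ℕ → Ω → κ} (hK : ∀ n, Measurable (K n))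
    (hind : iIndepFun K μ) (n : ℕ) :
    Indep (MeasurableSpace.comap (K n) inferInstance) (pastSigma K n) μ := by
  have := indep_iSup_of_disjoint (fun k => (hK k).comap_le) hind
    (S := {n}) (T := Set.Iio n) (by simp)
  rwa [iSup_singleton] at this

/-- The ergodic theorem for a finite chain that is driven by independent, identically distributed
variables, for a function for which the Poisson equation is solvable. -/
theorem ae_tendsto_average_of_poisson {S : Type*} [Finite S] {K : ℕ → Ω → κ} {p : κ → ℝ}
    (hK : ∀ n, Measurable (K n)) (hind : iIndepFun K μ)
    (hlaw : ∀ n k, μ.real {ω | K n ω = k} = p k)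
    {X : ℕ → Ω → S} {x₀ : κ → S} {F : S → κ → S} (hX₀ : ∀ ω, X 0 ω = x₀ (K 0 ω))
    (hX : ∀ n ω, X (n + 1) ω = F (X n ω) (K (n + 1) ω))
    {f g : S → ℝ} {c : ℝ} (hg : ∀ s, f s - c = g s - ∑ k, p k * g (F s k)) :
    ∀ᵐ ω ∂μ, Tendsto (fun N : ℕ => (1 / (N : ℝ)) * ∑ j ∈ Finset.range N, f (X j ω))
      atTop (𝓝 c) := by
  classical
  let _ : MeasurableSpace S := ⊤
  have hKp : ∀ {i n}, i < n → Measurable[pastSigma K n] (K i) := fun {i n} h =>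
    Measurable.of_comap_le (le_iSup₂_of_le i h le_rfl)
  have hmono : ∀ {m n}, m ≤ n → pastSigma K m ≤ pastSigma K n := fun h =>
    biSup_mono fun i hi => lt_of_lt_of_le hi h
  have hpast : ∀ n, pastSigma K n ≤ ‹MeasurableSpace Ω› := fun n =>
    iSup₂_le fun i _ => (hK i).comap_le
  -- `X n` uses the variables up to and including index `n`, whereas `pastSigma K n` stops before
  -- `n`; hence the shift.
  have hXp : ∀ n, Measurable[pastSigma K (n + 1)] (X n) := by
    intro n
    induction n with
    | zero =>
      rw [funext hX₀]
      exact (measurable_of_finite x₀).comp (hKp zero_lt_one)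
    | succ n ih =>
      rw [funext (hX n)]
      exact (measurable_of_finite fun q : S × κ => F q.1 q.2).comp
        (Measurable.prodMk (ih.mono (hmono (by lia)) le_rfl) (hKp (by lia)))
  obtain ⟨b, hb⟩ : ∃ b, ∀ s, |g s| ≤ b := by
    obtain ⟨b, hb⟩ := (Set.finite_range fun s => |g s|).bddAbove
    exact ⟨b, fun s => hb ⟨s, rfl⟩⟩
  have hp0 : ∀ k, 0 ≤ p k := fun k => hlaw 0 k ▸ measureReal_nonneg
  -- The martingale difference: the subtracted sum is the conditional mean of `g (X (n + 1))` given
  -- the past.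
  set D : ℕ → Ω → ℝ := fun n ω => g (X (n + 1) ω) - ∑ k, p k * g (F (X n ω) k) with hDdef
  have hDp : ∀ n, Measurable[pastSigma K (n + 2)] (D n) := fun n =>
    Measurable.sub ((measurable_of_finite g).comp (hXp (n + 1)))
      ((measurable_of_finite fun s => ∑ k, p k * g (F s k)).comp
        ((hXp n).mono (hmono (by lia)) le_rfl))
  have hDb : ∀ n ω, |D n ω| ≤ b + ∑ k, p k * b := fun n ω => by
    refine (abs_sub _ _).trans (add_le_add (hb _) ((Finset.abs_sum_le_sum_abs _ _).trans ?_))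
    refine Finset.sum_le_sum fun k _ => ?_
    rw [abs_mul, abs_of_nonneg (hp0 k)]
    exact mul_le_mul_of_nonneg_left (hb _) (hp0 k)
  -- Centred indicators write `D n` as a finite sum of mean-zero functions of the fresh variable
  -- times functions of the past, so orthogonality follows from plain independence.
  set q : κ → κ → ℝ := fun k l => (if l = k then 1 else 0) - p k with hq
  have hDq : ∀ n ω, D n ω = ∑ k, q k (K (n + 1) ω) * g (F (X n ω) k) := fun n ω => by
    simp [hDdef, hq, hX, sub_mul, Finset.sum_sub_distrib]
  have hq0 : ∀ n k, ∫ ω, q k (K n ω) ∂μ = 0 := fun n k => by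
    have hms : MeasurableSet {ω | K n ω = k} := hK n (measurableSet_singleton k)
    have h1 : ∀ ω, (if K n ω = k then (1 : ℝ) else 0) = {ω | K n ω = k}.indicator 1 ω := fun ω => by
      simp [Set.indicator_apply]
    simp only [hq, h1]
    have h2 : Integrable ({ω | K n ω = k}.indicator (1 : Ω → ℝ)) μ :=
      (integrable_indicator_iff hms).2 (integrable_const (1 : ℝ)).integrableOn
    rw [integral_sub h2 (integrable_const _), integral_indicator_one hms, hlaw]
    simp
  have horth : ∀ n, ∫ ω, (∑ i ∈ Finset.range n, D i ω) * D n ω ∂μ = 0 := by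
    intro n
    have hMp : Measurable[pastSigma K (n + 1)] fun ω => ∑ i ∈ Finset.range n, D i ω :=
      Finset.measurable_fun_sum _ fun i hi =>
        (hDp i).mono (hmono (by have := Finset.mem_range.1 hi; lia)) le_rfl
    have hZp : ∀ k, Measurable[pastSigma K (n + 1)]
        fun ω => (∑ i ∈ Finset.range n, D i ω) * g (F (X n ω) k) := fun k =>
      Measurable.mul hMp ((measurable_of_finite fun s => g (F s k)).comp (hXp n))
    have hqm : ∀ k, Measurable fun ω => q k (K (n + 1) ω) := fun k =>
      (measurable_of_finite (q k)).comp (hK (n + 1))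
    have hind' : ∀ k, IndepFun (fun ω => q k (K (n + 1) ω))
        (fun ω => (∑ i ∈ Finset.range n, D i ω) * g (F (X n ω) k)) μ := fun k => by
      rw [IndepFun_iff_Indep]
      refine indep_of_indep_of_le_left (indep_of_indep_of_le_right
        (hind.indep_pastSigma hK (n + 1)) (hZp k).comap_le) ?_
      rw [← Function.comp_def, ← MeasurableSpace.comap_comp]
      exact MeasurableSpace.comap_mono (measurable_of_finite (q k)).comap_le
    have hMb : ∀ ω, |∑ i ∈ Finset.range n, D i ω| ≤ n * (b + ∑ k, p k * b) := fun ω =>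
      (Finset.abs_sum_le_sum_abs _ _).trans
        ((Finset.sum_le_sum fun i _ => hDb i ω).trans (by simp [mul_add]))
    have hqb : ∀ k l, |q k l| ≤ 1 + p k := fun k l => by
      refine (abs_sub _ _).trans ?_
      rw [abs_of_nonneg (hp0 k)]
      gcongr
      split_ifs <;> simp
    have hint : ∀ k, Integrable (fun ω => q k (K (n + 1) ω) *
        ((∑ i ∈ Finset.range n, D i ω) * g (F (X n ω) k))) μ := fun k => by
      refine Integrable.of_bound
        ((hqm k).mul ((hZp k).mono (hpast _) le_rfl)).aestronglyMeasurable
        ((1 + p k) * (n * (b + ∑ k, p k * b) * b)) (ae_of_all _ fun ω => ?_)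
      rw [Real.norm_eq_abs, abs_mul, abs_mul]
      have hM0 := (abs_nonneg _).trans (hMb ω)
      exact mul_le_mul (hqb _ _) (mul_le_mul (hMb ω) (hb _) (abs_nonneg _) hM0)
        (by positivity) (by linarith [hp0 k])
    calc _ = ∫ ω, ∑ k, q k (K (n + 1) ω) *
          ((∑ i ∈ Finset.range n, D i ω) * g (F (X n ω) k)) ∂μ := by
          congr 1 with ω
          rw [hDq n, Finset.mul_sum]
          exact Finset.sum_congr rfl fun k _ => by ring
      _ = ∑ k, 0 := by
          rw [integral_finsetSum _ fun k _ => hint k]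
          refine Finset.sum_congr rfl fun k _ => ?_
          rw [(hind' k).integral_fun_mul_eq_mul_integral (hqm k).aestronglyMeasurable
            ((hZp k).mono (hpast _) le_rfl).aestronglyMeasurable, hq0, zero_mul]
      _ = 0 := by simp
  have hlln := ae_tendsto_average_of_orthogonal (fun n => (hDp n).mono (hpast _) le_rfl) hDb horth
  filter_upwards [hlln] with ω hω
  have htel : ∀ N : ℕ, ∑ j ∈ Finset.range N, (f (X j ω) - c)
      = g (X 0 ω) - g (X N ω) + ∑ j ∈ Finset.range N, D j ω := fun N => by
    rw [← Finset.sum_range_sub' (fun j => g (X j ω)), ← Finset.sum_add_distrib]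
    refine Finset.sum_congr rfl fun j _ => ?_
    rw [hg, hDdef]
    ring
  have hbd : Tendsto (fun N : ℕ => (g (X 0 ω) - g (X N ω)) / (N : ℝ)) atTop (𝓝 0) := by
    refine squeeze_zero_norm (fun N => ?_) (tendsto_const_div_atTop_nhds_zero_nat (b + b))
    rw [norm_div, Real.norm_natCast, Real.norm_eq_abs]
    gcongr
    exact (abs_sub _ _).trans (add_le_add (hb _) (hb _))
  have hlim := (hbd.add hω).add_const c
  rw [zero_add, zero_add] at hlim
  refine hlim.congr' ?_
  filter_upwards [eventually_ge_atTop 1] with N hN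
  have hN0 : (N : ℝ) ≠ 0 := by positivity
  rw [← add_div, ← htel, Finset.sum_sub_distrib]
  simp only [Finset.sum_const, Finset.card_range, nsmul_eq_mul]
  field_simp
  ring

end ProbabilityTheory

/-! ### The cumulative service function -/

theorem sub_mul_floor_mem_Icc {T : ℝ} (hT : 0 < T) {t : ℝ} (ht : 0 ≤ t) :
    t - T * ⌊t / T⌋₊ ∈ Set.Icc 0 T := by
  have h1 := Nat.floor_le (div_nonneg ht hT.le)
  have h2 := (Nat.lt_floor_add_one (t / T)).le
  rw [le_div_iff₀ hT] at h1
  rw [div_le_iff₀ hT] at h2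
  constructor <;> linarith

/-- Gluing monotone pieces on intervals of length `T` to a monotone function. -/
theorem monotoneOn_sum_floor {T : ℝ} (hT : 0 < T) {g : ℕ → ℝ → ℝ} (h0 : ∀ l, g l 0 = 0)
    (hg : ∀ l, MonotoneOn (g l) (Set.Icc 0 T)) :
    MonotoneOn (fun t => ∑ l ∈ Finset.range ⌊t / T⌋₊, g l T + g ⌊t / T⌋₊ (t - T * ⌊t / T⌋₊))
      (Set.Ici 0) := by
  have hT' : T ∈ Set.Icc 0 T := Set.right_mem_Icc.2 hT.le
  have hnonneg : ∀ l, ∀ t ∈ Set.Icc 0 T, 0 ≤ g l t := fun l t ht =>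
    h0 l ▸ hg l (Set.left_mem_Icc.2 hT.le) ht ht.1
  intro s hs t ht hst
  rw [Set.mem_Ici] at hs ht
  have hle : ⌊s / T⌋₊ ≤ ⌊t / T⌋₊ := Nat.floor_mono (by gcongr)
  have hrs := sub_mul_floor_mem_Icc hT hs
  have hrt := sub_mul_floor_mem_Icc hT ht
  simp only
  generalize ⌊s / T⌋₊ = m at *
  generalize ⌊t / T⌋₊ = n at *
  rcases hle.eq_or_lt with rfl | hlt
  · gcongr
    exact hg _ hrs hrt (by linarith)
  · calc _ ≤ ∑ l ∈ Finset.range m, g l T + g m T := by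
          gcongr
          exact hg _ hrs hT' hrs.2
      _ = ∑ l ∈ Finset.range (m + 1), g l T := (Finset.sum_range_succ _ _).symm
      _ ≤ ∑ l ∈ Finset.range n, g l T :=
          Finset.sum_le_sum_of_subset_of_nonneg (Finset.range_mono hlt)
            fun l _ _ => hnonneg l T hT'
      _ ≤ _ := le_add_of_nonneg_right (hnonneg _ _ hrt)

namespace SupplyFunctions

variable {T : ℝ} (G : SupplyFunctions T)

theorem service_zero_left (t : ℝ) : service G 0 t =
    ∑ l ∈ Finset.range ⌊t / T⌋₊, G.β l T + G.β ⌊t / T⌋₊ (t - T * ⌊t / T⌋₊) := by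
  simp [service]

theorem service_mono (hT : 0 < T) : MonotoneOn (service G 0) (Set.Ici 0) := by
  rw [funext G.service_zero_left]
  exact monotoneOn_sum_floor hT G.β_zero G.β_mono

/-- The rate bound says that `t - G.β l t` is monotone on each period; gluing these pieces gives `t
- service G 0 t`. -/
theorem service_sub_le (hT : 0 < T) {s t : ℝ} (hs : 0 ≤ s) (hst : s ≤ t) :
    service G 0 t - service G 0 s ≤ t - s := by
  have h := monotoneOn_sum_floor hT (g := fun l t => t - G.β l t) (fun l => by simp [G.β_zero])
    (fun l a ha b hb hab => by
      rcases hab.eq_or_lt with rfl | hlt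
      · exact le_rfl
      · have := G.β_rate l a (b - a) ha.1 (by linarith) (by linarith [hb.2])
        rw [add_sub_cancel] at this
        simp only
        linarith) hs (hs.trans hst : t ∈ Set.Ici 0) hst
  simp only [Finset.sum_sub_distrib, Finset.sum_const, Finset.card_range, nsmul_eq_mul] at h
  rw [service_zero_left, service_zero_left]
  linarith

theorem service_zero_natCast_mul (hT : 0 < T) (j : ℕ) :
    service G 0 (j * T) = ∑ l ∈ Finset.range j, G.β l T := by
  rw [service_zero_left, mul_div_cancel_right₀ _ hT.ne', Nat.floor_natCast, mul_comm, sub_self,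
    G.β_zero, add_zero]

theorem service_eq_sub (hT : 0 < T) (j : ℕ) {t : ℝ} (ht : 0 ≤ t) :
    service G j t = service G 0 (j * T + t) - service G 0 (j * T) := by
  have hfl : ⌊(j * T + t) / T⌋₊ = j + ⌊t / T⌋₊ := by
    rw [add_div, mul_div_cancel_right₀ _ hT.ne', add_comm, Nat.floor_add_natCast (by positivity),
      add_comm]
  rw [service_zero_natCast_mul G hT, service_zero_left, hfl, service,
    ← Finset.sum_range_add_sum_Ico _ (Nat.le_add_right j ⌊t / T⌋₊)]
  have : (j : ℝ) * T + t - T * (j + ⌊t / T⌋₊ : ℕ) = t - T * ⌊t / T⌋₊ := by push_cast; ring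
  rw [this]
  ring

theorem service_le_service (hT : 0 < T) (j : ℕ) {s t : ℝ} (hs : 0 ≤ s) (hst : s ≤ t) :
    service G j s ≤ service G j t := by
  rw [G.service_eq_sub hT j hs, G.service_eq_sub hT j (hs.trans hst)]
  have : (0 : ℝ) ≤ j * T := by positivity
  exact sub_le_sub_right (G.service_mono hT (add_nonneg this hs)
    (add_nonneg this (hs.trans hst)) (by linarith)) _

theorem service_nonneg (hT : 0 < T) (j : ℕ) {t : ℝ} (ht : 0 ≤ t) : 0 ≤ service G j t := by
  rw [G.service_eq_sub hT j ht, sub_nonneg]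
  have : (0 : ℝ) ≤ j * T := by positivity
  exact G.service_mono hT this (add_nonneg this ht) (by linarith)

theorem β_nonneg (hT : 0 < T) (j : ℕ) : 0 ≤ G.β j T :=
  G.β_zero j ▸ G.β_mono j (Set.left_mem_Icc.2 hT.le) (Set.right_mem_Icc.2 hT.le) hT.le

theorem β_add_mul (j k : ℕ) {t : ℝ} (ht : t ∈ Set.Icc 0 T) : G.β (j + G.Q * k) t = G.β j t := by
  induction k with
  | zero => simp
  | succ k ih => rw [mul_add, mul_one, ← add_assoc, G.β_periodic _ t ht, ih]

theorem β_mod (j : ℕ) {t : ℝ} (ht : t ∈ Set.Icc 0 T) : G.β (j % G.Q) t = G.β j t := by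
  conv_rhs => rw [← Nat.mod_add_div j G.Q]
  rw [G.β_add_mul _ _ ht]

theorem service_mod (hT : 0 < T) (j : ℕ) {t : ℝ} (ht : 0 ≤ t) :
    service G (j % G.Q) t = service G j t := by
  have hT' : T ∈ Set.Icc 0 T := Set.right_mem_Icc.2 hT.le
  conv_rhs => rw [← Nat.mod_add_div j G.Q]
  simp only [service, Finset.sum_Ico_eq_sum_range, add_tsub_cancel_left]
  congr 1
  · refine Finset.sum_congr rfl fun i _ => ?_
    rw [add_right_comm, G.β_add_mul _ _ hT']
  · rw [add_right_comm, G.β_add_mul _ _ (sub_mul_floor_mem_Icc hT ht)]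

end SupplyFunctions

/-! ### The schedule as a recursion for the backlog -/

namespace SoftTask

variable (τ : SoftTask) (G : SupplyFunctions τ.T)

section leaveTime

variable {a x : ℝ} {j : ℕ}

theorem leaveTime_mem_Icc (had : a ≤ τ.dismissPoint j) :
    τ.leaveTime G a x j ∈ Set.Icc a (τ.dismissPoint j) :=
  ⟨le_csInf ⟨_, had, Or.inr le_rfl⟩ fun _ ht => ht.1,
    csInf_le ⟨a, fun _ ht => ht.1⟩ ⟨had, Or.inr le_rfl⟩⟩

/-- Service cannot jump, so at the infimum the job has received exactly `x`, unless the dismiss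
point cuts it off. This turns leave times into amounts of service. -/
theorem service_leaveTime (ha : 0 ≤ a) (hx : 0 ≤ x) (had : a ≤ τ.dismissPoint j) :
    service G 0 (τ.leaveTime G a x j)
      = min (service G 0 a + x) (service G 0 (τ.dismissPoint j)) := by
  obtain ⟨haL, hLd⟩ := τ.leaveTime_mem_Icc G (x := x) had
  have hbdd : BddBelow {t : ℝ | a ≤ t ∧ (x ≤ service G 0 t - service G 0 a ∨
    τ.dismissPoint j ≤ t)} := ⟨a, fun _ ht => ht.1⟩
  have hmem : τ.dismissPoint j ∈ {t : ℝ | a ≤ t ∧ (x ≤ service G 0 t - service G 0 a ∨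
    τ.dismissPoint j ≤ t)} := ⟨had, Or.inr le_rfl⟩
  set L := τ.leaveTime G a x j with hL
  refine le_antisymm (le_min ?_ ?_) ?_
  -- Going back from `L` by the excess service loses at most that excess, so the job was already
  -- finished at an earlier time.
  · by_contra! hlt
    have h1 := G.service_sub_le τ.T_pos ha haL
    have hat : a ≤ L - (service G 0 L - service G 0 a - x) := by linarith
    have h2 := G.service_sub_le τ.T_pos (ha.trans hat)
      (by linarith : L - (service G 0 L - service G 0 a - x) ≤ L)
    have h3 : L ≤ L - (service G 0 L - service G 0 a - x) :=
      csInf_le hbdd ⟨hat, Or.inl (by linarith)⟩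
    linarith
  · exact G.service_mono τ.T_pos (ha.trans haL) (ha.trans had) hLd
  -- Some `t` in the set exceeds `L` by less than the deficit; service grows no faster than time, so
  -- neither exit condition holds at `t`.
  · by_contra! hlt
    obtain ⟨hlt1, hlt2⟩ := lt_min_iff.1 hlt
    obtain ⟨t, ht, htL⟩ := exists_lt_of_csInf_lt ⟨_, hmem⟩
      (lt_add_of_pos_right L (sub_pos.2 hlt) : _ < _)
    have hLt : L ≤ t := csInf_le hbdd ht
    have h1 := G.service_sub_le τ.T_pos (ha.trans haL) hLt
    have h2 : service G 0 t < min (service G 0 a + x) (service G 0 (τ.dismissPoint j)) := by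
      linarith
    obtain ⟨h3, h4⟩ := lt_min_iff.1 h2
    rcases ht.2 with h | h
    · linarith
    · exact h4.not_ge (G.service_mono τ.T_pos (ha.trans had) (ha.trans ht.1) h)

end leaveTime

variable (c : ℕ → ℝ)

theorem release_nonneg (j : ℕ) : 0 ≤ τ.release j := mul_nonneg j.cast_nonneg τ.T_pos.le

/-- A job leaves by its dismiss point, and dismiss points increase, so no job is held up beyond its
own. -/
theorem startTime_mem_Icc (j : ℕ) :
    τ.startTime G c j ∈ Set.Icc (τ.release j) (τ.dismissPoint j) := by
  have hD := τ.D_pos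
  have hδ := τ.δ_nonneg
  have hT := τ.T_pos
  have hrd : ∀ j, τ.release j ≤ τ.dismissPoint j := fun j => by
    simp only [release, dismissPoint]; linarith
  induction j with
  | zero => exact ⟨le_rfl, hrd 0⟩
  | succ j ih =>
    refine ⟨le_max_left _ _, max_le (hrd _) ((τ.leaveTime_mem_Icc G ih.2).2.trans ?_)⟩
    simp only [dismissPoint]; push_cast; linarith

/-- The work that is to be executed before job `j`, at its release. -/
noncomputable def backlog (j : ℕ) : ℝ :=
  service G 0 (τ.startTime G c j) - service G 0 (τ.release j)

variable {c}

theorem backlog_zero : τ.backlog G c 0 = 0 := sub_self _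

/-- Monotone cumulative service carries the maximum of release and leave time to a maximum of
services; `service_leaveTime` supplies the minimum. -/
theorem backlog_succ (hc : ∀ j, 0 < c j) (j : ℕ) :
    τ.backlog G c (j + 1) =
      max (min (c j + τ.backlog G c j) (service G j (τ.D + τ.δ)) - G.β j τ.T) 0 := by
  have hs := τ.startTime_mem_Icc G c j
  have hs0 := (τ.release_nonneg j).trans hs.1
  have hL := τ.service_leaveTime G hs0 (hc j).le hs.2
  have hmax : service G 0 (τ.startTime G c (j + 1)) = max (service G 0 (τ.release (j + 1)))
      (service G 0 (τ.leaveTime G (τ.startTime G c j) (c j) j)) :=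
    (G.service_mono τ.T_pos).map_max (τ.release_nonneg _)
      (hs0.trans (τ.leaveTime_mem_Icc G hs.2).1)
  have hrel : service G 0 (τ.release (j + 1)) = service G 0 (τ.release j) + G.β j τ.T := by
    simp only [release, G.service_zero_natCast_mul τ.T_pos, Finset.sum_range_succ]
  have hdis : service G j (τ.D + τ.δ)
      = service G 0 (τ.dismissPoint j) - service G 0 (τ.release j) := by
    rw [G.service_eq_sub τ.T_pos j (add_nonneg τ.D_pos.le τ.δ_nonneg), ← add_assoc]
    rfl
  rw [backlog, hmax, hL, hrel, hdis, backlog, max_comm, ← max_sub_sub_right]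
  congr 1
  · rw [sub_add_eq_sub_sub, ← min_sub_sub_right]
    congr 2
    ring
  · ring

theorem meetsDeadline_iff (hc : ∀ j, 0 < c j) (j : ℕ) :
    τ.MeetsDeadline G c j ↔ c j + τ.backlog G c j ≤ service G j τ.D := by
  have hs0 := (τ.release_nonneg j).trans (τ.startTime_mem_Icc G c j).1
  have hd0 : 0 ≤ τ.deadline j := add_nonneg (τ.release_nonneg j) τ.D_pos.le
  have hD : service G j τ.D = service G 0 (τ.deadline j) - service G 0 (τ.release j) :=
    G.service_eq_sub τ.T_pos j τ.D_pos.le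
  rw [hD, backlog]
  constructor
  · rintro ⟨t, hst, htd, h⟩
    have := G.service_mono τ.T_pos (hs0.trans hst) hd0 htd
    linarith
  · intro h
    refine ⟨τ.deadline j, ?_, le_rfl, by linarith⟩
    -- A start after the deadline would leave a nonpositive amount of service for `c j`, which is
    -- positive.
    by_contra! hlt
    have := G.service_mono τ.T_pos hd0 hs0 hlt.le
    linarith [hc j]

variable (c) in
/-- The state of the chain that job `j` of the schedule is in. -/
noncomputable def jobState (j : ℕ) : ChainState :=
  τ.expand G (j % G.Q) (τ.backlog G c j) (c j)

theorem jobState_zero : τ.jobState G c 0 = τ.expand G 0 0 (c 0) := by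
  rw [jobState, backlog_zero, Nat.zero_mod]

@[simp]
theorem expand_pos (i : ℕ) (w x : ℝ) : (τ.expand G i w x).pos = i := by
  unfold expand; split_ifs <;> rfl

/-- The two branches agree: in a hit, `x + w` is at most the service until the deadline, so the
truncation at the dismiss point is inactive. -/
theorem expand_rem (i : ℕ) (w x : ℝ) : (τ.expand G i w x).rem =
    max (min (x + w) (service G i (τ.D + τ.δ)) - G.β i τ.T) 0 := by
  unfold expand
  split_ifs with h
  · rw [min_eq_left (h.trans (G.service_le_service τ.T_pos i τ.D_pos.le
      (le_add_of_nonneg_right τ.δ_nonneg)))]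
  · rw [add_comm w x]

theorem expand_miss_iff (i : ℕ) (w x : ℝ) :
    (τ.expand G i w x).miss = true ↔ ¬ x + w ≤ service G i τ.D := by
  unfold expand; split_ifs with h <;> simp [h]

theorem jobState_rem (hc : ∀ j, 0 < c j) (j : ℕ) :
    (τ.jobState G c j).rem = τ.backlog G c (j + 1) := by
  rw [jobState, expand_rem, backlog_succ τ G hc,
    G.service_mod τ.T_pos j (add_nonneg τ.D_pos.le τ.δ_nonneg),
    G.β_mod j (Set.right_mem_Icc.2 τ.T_pos.le)]

theorem jobState_succ (hc : ∀ j, 0 < c j) (j : ℕ) : τ.jobState G c (j + 1) =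
    τ.expand G (((τ.jobState G c j).pos + 1) % G.Q) (τ.jobState G c j).rem (c (j + 1)) := by
  rw [jobState_rem τ G hc, jobState, jobState, expand_pos, Nat.mod_add_mod]

theorem DM_eq_ite_miss (hc : ∀ j, 0 < c j) (j : ℕ) :
    τ.DM G c j = if (τ.jobState G c j).miss = true then 1 else 0 := by
  have : τ.MeetsDeadline G c j ↔ ¬ (τ.jobState G c j).miss = true := by
    rw [jobState, expand_miss_iff, not_not, G.service_mod τ.T_pos j τ.D_pos.le,
      meetsDeadline_iff τ G hc]
  unfold DM
  by_cases h : (τ.jobState G c j).miss = true <;> simp [this, h]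

end SoftTask

namespace SoftTask

variable {τ : SoftTask} {G : SupplyFunctions τ.T}

/-! ### Finiteness in the integral case -/

/-- Subtracting whole periods from an integer time leaves an integer in `[0, T]`, where the supply
is integral by assumption. -/
theorem IsIntegral.exists_service_eq (hI : τ.IsIntegral G) (i : ℕ) {t : ℝ} (ht : 0 ≤ t)
    (htZ : ∃ n : ℤ, t = n) : ∃ n : ℤ, service G i t = n := by
  obtain ⟨⟨T', hT'⟩, -, -, -, hβ⟩ := hI
  obtain ⟨t', rfl⟩ := htZ
  have hβT : ∀ l, ∃ n : ℤ, G.β l τ.T = n := fun l => by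
    have h0 : 0 ≤ T' := by exact_mod_cast hT' ▸ τ.T_pos.le
    lift T' to ℕ using h0
    have := hβ l T' (by simp [hT'])
    simpa [hT'] using this
  choose b hb using hβT
  have hrest := sub_mul_floor_mem_Icc τ.T_pos ht
  set m := ⌊(t' : ℝ) / τ.T⌋₊ with hm
  obtain ⟨r, hr⟩ : ∃ r : ℤ, (t' : ℝ) - τ.T * m = r := ⟨t' - T' * m, by rw [hT']; push_cast; rfl⟩
  have hr0 : 0 ≤ r := by exact_mod_cast hr ▸ hrest.1
  lift r to ℕ using hr0
  obtain ⟨n, hn⟩ := hβ (i + m) r (by simpa [hr] using hrest.2)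
  refine ⟨∑ l ∈ Finset.Ico i (i + m), b l + n, ?_⟩
  have hr' : (t' : ℝ) - τ.T * m = (r : ℝ) := by simpa using hr
  rw [service, ← hm, hr', hn]
  simp [hb]

theorem IsIntegral.exists_β_eq (hI : τ.IsIntegral G) (i : ℕ) : ∃ n : ℤ, G.β i τ.T = n := by
  have h := hI.exists_service_eq i τ.T_pos.le hI.1
  simpa [service, div_self τ.T_pos.ne', G.β_zero] using h

/-- A created state has a reduced position and a nonnegative backlog that is at most the service until the dismiss
point. -/
theorem IsCreated.bounds {s : ChainState} (hs : τ.IsCreated G s) :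
    s.pos < G.Q ∧ 0 ≤ s.rem ∧ s.rem ≤ service G s.pos (τ.D + τ.δ) := by
  have key : ∀ i w x, i < G.Q → (τ.expand G i w x).pos < G.Q ∧ 0 ≤ (τ.expand G i w x).rem ∧
      (τ.expand G i w x).rem ≤ service G (τ.expand G i w x).pos (τ.D + τ.δ) := by
    intro i w x hi
    rw [expand_pos, expand_rem]
    refine ⟨hi, le_max_right _ _, max_le ?_
      (G.service_nonneg τ.T_pos i (add_nonneg τ.D_pos.le τ.δ_nonneg))⟩
    have h1 := G.β_nonneg τ.T_pos i
    have h2 := min_le_right (x + w) (service G i (τ.D + τ.δ))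
    linarith
  cases hs with
  | init k => exact key _ _ _ G.Q_pos
  | next s k _ => exact key _ _ _ (Nat.mod_lt _ G.Q_pos)

theorem IsIntegral.exists_rem_eq (hI : τ.IsIntegral G) {s : ChainState} (hs : τ.IsCreated G s) :
    ∃ n : ℤ, s.rem = n := by
  have key : ∀ (i : ℕ) (w x : ℝ), (∃ n : ℤ, w = n) → (∃ n : ℤ, x = n) →
      ∃ n : ℤ, (τ.expand G i w x).rem = n := by
    rintro i _ _ ⟨w, rfl⟩ ⟨x, rfl⟩
    obtain ⟨d, hd⟩ := hI.2.1
    obtain ⟨δ, hδ⟩ := hI.2.2.1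
    obtain ⟨a, ha⟩ := hI.exists_service_eq i (add_nonneg τ.D_pos.le τ.δ_nonneg)
      ⟨d + δ, by rw [hd, hδ]; push_cast; rfl⟩
    obtain ⟨b, hb⟩ := hI.exists_β_eq i
    refine ⟨max (min (x + w) a - b) 0, ?_⟩
    rw [expand_rem, ha, hb]
    push_cast
    rfl
  have he := hI.2.2.2.1
  induction hs with
  | init k => exact key _ _ _ ⟨0, Int.cast_zero.symm⟩ (he k)
  | next s k _ ih => exact key _ _ _ ih (he k)

theorem IsIntegral.finite_state (hI : τ.IsIntegral G) : Finite (τ.State G) := by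
  obtain ⟨B, hB⟩ : ∃ B, ∀ i < G.Q, service G i (τ.D + τ.δ) ≤ B := by
    obtain ⟨B, hB⟩ := ((Finset.range G.Q).image fun i => service G i (τ.D + τ.δ)).bddAbove
    exact ⟨B, fun i hi => hB (Finset.mem_image_of_mem _ (Finset.mem_range.2 hi))⟩
  have hfin : ((fun q : ℕ × Bool × ℤ => (⟨q.1, q.2.1, q.2.2⟩ : ChainState)) ''
      (Set.Iio G.Q ×ˢ Set.univ ×ˢ Set.Icc 0 ⌊B⌋)).Finite :=
    ((Set.finite_Iio _).prod (Set.finite_univ.prod (Set.finite_Icc _ _))).image _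
  refine (hfin.subset ?_ : {s | τ.IsCreated G s}.Finite).to_subtype
  intro s hs
  obtain ⟨h1, h2, h3⟩ := IsCreated.bounds hs
  obtain ⟨n, hn⟩ := hI.exists_rem_eq hs
  refine ⟨(s.pos, s.miss, n), ⟨h1, Set.mem_univ _, ?_, ?_⟩, ?_⟩
  · exact_mod_cast hn ▸ h2
  · exact Int.le_floor.2 (hn ▸ h3.trans (hB _ h1))
  · ext <;> simp [hn]

/-! ### The chain and the schedule -/

variable (τ G)

/-- The successor of a state, as a state. -/
noncomputable def succState (s : τ.State G) (k : Fin τ.h) : τ.State G :=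
  ⟨τ.nextState G s k, .next s k s.2⟩

/-- Undoes the merging of successors: averaging over states becomes averaging over execution times,
the form that the random recursion uses. -/
theorem sum_transitionMatrix_mul [Fintype (τ.State G)] (g : τ.State G → ℝ) (s : τ.State G) :
    ∑ r, τ.transitionMatrix G r s * g r = ∑ k, τ.p k * g (τ.succState G s k) := by
  classical
  have h : ∀ (r : τ.State G) (k : Fin τ.h),
      τ.nextState G s k = r ↔ τ.succState G s k = r := fun r k =>
    (Subtype.ext_iff (a1 := τ.succState G s k)).symm
  simp only [transitionMatrix, Finset.sum_filter, h, Finset.sum_mul]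
  rw [Finset.sum_comm]
  simp

theorem sum_transitionMatrix [Fintype (τ.State G)] (s : τ.State G) :
    ∑ r, τ.transitionMatrix G r s = 1 := by
  simpa [τ.p_sum] using τ.sum_transitionMatrix_mul G (fun _ => 1) s

theorem h_pos : 0 < τ.h := by
  rcases Nat.eq_zero_or_pos τ.h with h | h
  · have : IsEmpty (Fin τ.h) := by rw [h]; infer_instance
    simpa using τ.p_sum
  · exact h

theorem isCreated_jobState (κ : ℕ → Fin τ.h) (j : ℕ) :
    τ.IsCreated G (τ.jobState G (fun j => τ.e (κ j)) j) := by
  induction j with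
  | zero => rw [jobState_zero]; exact .init (κ 0)
  | succ j ih =>
    rw [jobState_succ τ G fun j => τ.e_pos _]
    exact .next _ (κ (j + 1)) ih

variable {τ G}

namespace IsExecutionTimes

variable {Ω : Type*} [MeasurableSpace Ω] {μ : Measure Ω} {C : ℕ → Ω → ℝ}

/-- The execution times are driven by independent random indices. -/
theorem exists_index [IsProbabilityMeasure μ] (hC : τ.IsExecutionTimes μ C) :
    ∃ K : ℕ → Ω → Fin τ.h, (∀ j, Measurable (K j)) ∧ iIndepFun K μ ∧
      (∀ j k, μ.real {ω | K j ω = k} = τ.p k) ∧ ∀ᵐ ω ∂μ, ∀ j, C j ω = τ.e (K j ω) := by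
  have : NeZero τ.h := ⟨τ.h_pos.ne'⟩
  have hemb : MeasurableEmbedding τ.e :=
    ⟨τ.e_strictMono.injective, measurable_of_finite _, fun s _ => (s.toFinite.image _).measurableSet⟩
  -- A left inverse of `τ.e`; the default `0` matters only on a null event, because the
  -- probabilities `τ.p k` sum to `1`.
  let κ : ℝ → Fin τ.h := Function.extend τ.e id fun _ => 0
  have hκ : Measurable κ := hemb.measurable_extend measurable_id measurable_const
  have hκe : ∀ k, κ (τ.e k) = k := fun k => τ.e_strictMono.injective.extend_apply _ _ k
  have hset : ∀ j k, MeasurableSet {ω | C j ω = τ.e k} := fun j k =>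
    hC.measurable j (measurableSet_singleton _)
  have hae : ∀ j, ∀ᵐ ω ∂μ, C j ω = τ.e (κ (C j ω)) := by
    intro j
    have h1 : μ.real (⋃ k, {ω | C j ω = τ.e k}) = 1 := by
      rw [measureReal_iUnion_fintype _ (hset j)]
      · simp only [hC.law, τ.p_sum]
      · intro k l hkl
        refine Set.disjoint_left.2 fun ω hk hl => hkl (τ.e_strictMono.injective ?_)
        exact (Set.mem_ofPred.1 hk).symm.trans hl
    have h2 : ∀ᵐ ω ∂μ, ω ∈ ⋃ k, {ω | C j ω = τ.e k} := by
      refine (prob_compl_eq_zero_iff (MeasurableSet.iUnion (hset j))).2 ?_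
      rw [measureReal_def] at h1
      exact (ENNReal.toReal_eq_one_iff _).1 h1
    filter_upwards [h2] with ω hω
    obtain ⟨k, hk⟩ := Set.mem_iUnion.1 hω
    rw [Set.mem_ofPred.1 hk, hκe]
  refine ⟨fun j ω => κ (C j ω), fun j => hκ.comp (hC.measurable j),
    hC.indep.comp (fun _ => κ) fun _ => hκ, fun j k => ?_, ae_all_iff.2 hae⟩
  rw [← hC.law j k]
  refine measureReal_congr ?_
  filter_upwards [hae j] with ω hω
  refine propext ⟨fun h => ?_, fun h => ?_⟩
  · exact hω.trans (congrArg τ.e h)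
  · exact (congrArg κ h).trans (hκe k)

theorem isDeadlineMissRate [IsProbabilityMeasure μ] [Fintype (τ.State G)]
    (hC : τ.IsExecutionTimes μ C) (hA : (τ.transitionMatrix G).IsIrreducible)
    {π : τ.State G → ℝ} (hπ : τ.IsStationary G π) :
    τ.IsDeadlineMissRate G μ C (∑ s with s.val.miss = true, π s) := by
  obtain ⟨K, hK, hind, hlaw, hae⟩ := hC.exists_index
  have : Nonempty (τ.State G) := ⟨⟨_, .init ⟨0, τ.h_pos⟩⟩⟩
  let f : τ.State G → ℝ := fun s => if s.val.miss = true then 1 else 0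
  obtain ⟨g, hg⟩ := hA.exists_poisson (τ.sum_transitionMatrix G) hπ.2.1 hπ.2.2 f
  simp only [sum_transitionMatrix_mul] at hg
  have hsum : ∑ r, π r * f r = ∑ s with s.val.miss = true, π s := by
    simp [f, Finset.sum_filter]
  rw [hsum] at hg
  let X : ℕ → Ω → τ.State G := fun j ω => ⟨_, τ.isCreated_jobState G (fun j => K j ω) j⟩
  have hlim := ae_tendsto_average_of_poisson (X := X)
    (x₀ := fun k => ⟨τ.initState G k, .init k⟩) hK hind hlaw
    (fun ω => Subtype.ext (τ.jobState_zero G (c := fun j => τ.e (K j ω))))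
    (fun n ω => Subtype.ext (τ.jobState_succ G (fun j => τ.e_pos (K j ω)) n)) hg
  filter_upwards [hlim, hae] with ω hω hCω
  simpa only [DMRN, hCω, τ.DM_eq_ite_miss G fun j => τ.e_pos (K j ω)] using hω

end IsExecutionTimes

end SoftTask

theorem theorem3 (τ : SoftTask) (G : SupplyFunctions τ.T) :
    (τ.IsIntegral G → Finite (τ.State G)) ∧
    ∀ [Fintype (τ.State G)], (τ.transitionMatrix G).IsIrreducible →
      ∃ π : τ.State G → ℝ,
        τ.IsStationary G π ∧ (∀ π', τ.IsStationary G π' → π' = π) ∧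
        ∀ {Ω : Type*} [MeasurableSpace Ω] (μ : Measure Ω) [IsProbabilityMeasure μ]
          (C : ℕ → Ω → ℝ), τ.IsExecutionTimes μ C →
          τ.IsDeadlineMissRate G μ C (∑ s with s.val.miss = true, π s) := by
  refine ⟨fun hI => hI.finite_state, fun hA => ?_⟩
  have : Nonempty (τ.State G) := ⟨⟨_, .init ⟨0, τ.h_pos⟩⟩⟩
  have hcol := τ.sum_transitionMatrix G
  obtain ⟨π, hπ⟩ := hA.exists_stationary hcol
  exact ⟨π, hπ, fun π' hπ' => hA.stationary_unique hcol hπ.2.1 hπ.2.2 hπ'.2.1 hπ'.2.2,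
    fun μ _ C hC => hC.isDeadlineMissRate hA hπ⟩
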